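/- **Theorem.** Every Sugihara monoid is representable; that is, $\mathsf{SM}\subseteq\mathsf{RSM}$. Here the notions are as follows. * A *Sugihara monoid* is an algebra $\mathbf A=\langle A,\wedge,\vee,\cdot,\to,1,{\sim}\rangle$ such that $\langle A,\wedge,\vee\rangle$ is a distributive lattice, $\langle A,\cdot,1\rangle$ is a commutative monoid with $a\cdot a=a$ for all $a$, the residuation law $a\cdot b\leqslant c\iff b\leqslant a\to c$ holds, and ${\sim}{\sim}a=a$ and $a\to{\sim}b=b\to{\sim}a$ for all $a,b\in A$. The class of all Sugihara monoids is $\mathsf{SM}$. * A *DInFL-algebra* is an algebra $\langle A,\wedge,\vee,\cdot,1,{\sim},-\rangle$ such that $\langle A,\wedge,\vee\rangle$ is a distributive lattice, $\langle A,\cdot,1\rangle$ is a monoid, and there are an element $0\in A$ and residuals $\backslash,/$ (that is, $a\cdot b\leqslant c\iff a\leqslant c/b\iff b\leqslant a\backslash c$) with ${\sim}a=a\backslash 0$, $-a=0/a$ and $-{\sim}a=a={\sim}{-}a$ for all $a\in A$. Its *direct reduct* is the algebra $\langle A,\wedge,\vee,\cdot,\to,1,{\sim}\rangle$ with $a\to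 b={\sim}(-b\cdot a)$. * Let $\mathbf X=\langle X,\leqslant\rangle$ be a poset and $\alpha$ an order automorphism of $\mathbf X$, regarded also as the binary relation $\{(x,\alpha(x))\mid x\in X\}$. Let $\mathsf{Up}(\mathbf X^{\partial}\times\mathbf X)$ be the set of all upsets of $\mathbf X^\partial\times\mathbf X$, where $\mathbf X^\partial=\langle X,\geqslant\rangle$ (equivalently, of all weakening relations, i.e. relations $R\subseteq X^2$ with ${\leqslant}\circ R\circ{\leqslant}=R$). The *full DInFL-algebra* given by $\mathbf X$ and $\alpha$ is $\langle\mathsf{Up}(\mathbf X^{\partial}\times\mathbf X),\cap,\cup,\circ,\leqslant,{\sim},-\rangle$, where $R\circ S=\{(x,y)\mid \exists z\,((x,z)\in R\text{ and }(z,y)\in S)\}$, ${\sim}R=R^{c\smile}\circ\alpha$ and $-R=\alpha\circ R^{c\smile}$, with $R^{c\smile}=\{(x,y)\mid (y,x)\notin R\}$. The class of these algebras is $\mathsf{FDInFL}$. * A DInFL-algebra is *representable* if it belongs to $\mathbb{ISP}(\mathsf{FDInFL})$, i.e. if it is isomorphic to a subalgebra of a direct product of full DInFL-algebras. A Sugihara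 monoid is *representable* if it is isomorphic to the direct reduct of a representable DInFL-algebra; $\mathsf{RSM}$ is the class of representable Sugihara monoids. -/

import Mathlib

universe u

namespace SugiharaRep

open scoped SetRel

/-! ### Sugihara monoids -/

/-- The signature `⟨∧, ∨, ·, →, 1, ∼⟩` of Sugihara monoids, without any laws. -/
class SugiharaSignature (A : Type u) extends Min A, Max A, Mul A, One A where
  /-- the implication `a → b` -/
  imp : A → A → A
  /-- the involution `∼a` -/
  neg : A → A

/-- A Sugihara monoid: a commutative distributive idempotent residuated lattice with an involution
`∼` satisfying `∼∼a = a` and `a → ∼b = b → ∼a`. -/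
class SugiharaMonoid (A : Type u) extends DistribLattice A, CommMonoid A where
  /-- the implication (residual of the commutative multiplication) -/
  imp : A → A → A
  /-- the involution -/
  neg : A → A
  mul_le_iff_le_imp : ∀ a b c : A, a * b ≤ c ↔ b ≤ imp a c
  mul_self : ∀ a : A, a * a = a
  neg_neg : ∀ a : A, neg (neg a) = a
  imp_neg_comm : ∀ a b : A, imp a (neg b) = imp b (neg a)

instance SugiharaMonoid.toSugiharaSignature (A : Type u) [SugiharaMonoid A] :
    SugiharaSignature A where
  imp := SugiharaMonoid.imp
  neg := SugiharaMonoid.neg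

/-- Isomorphisms of algebras in the signature `⟨∧, ∨, ·, →, 1, ∼⟩`. -/
structure SugiharaIso (A B : Type u) [SugiharaSignature A] [SugiharaSignature B]
    extends A ≃ B where
  map_inf : ∀ a b : A, toFun (a ⊓ b) = toFun a ⊓ toFun b
  map_sup : ∀ a b : A, toFun (a ⊔ b) = toFun a ⊔ toFun b
  map_mul : ∀ a b : A, toFun (a * b) = toFun a * toFun b
  map_imp : ∀ a b : A, toFun (SugiharaSignature.imp a b) =
    SugiharaSignature.imp (toFun a) (toFun b)
  map_one : toFun 1 = 1
  map_neg : ∀ a : A, toFun (SugiharaSignature.neg a) = SugiharaSignature.neg (toFun a)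

/-! ### DInFL-algebras -/

/-- `tilde` and `minus` are the linear negations `a ↦ a \ 0` and `a ↦ 0 / a` of an FL-algebra
structure on the lattice-ordered monoid `A`, and they satisfy the involutive property. -/
def IsInFL {A : Type u} [Lattice A] [Monoid A] (tilde minus : A → A) : Prop :=
  ∃ (zero : A) (ldiv rdiv : A → A → A),
    (∀ a b c : A, a * b ≤ c ↔ a ≤ rdiv c b) ∧
    (∀ a b c : A, a * b ≤ c ↔ b ≤ ldiv a c) ∧
    (∀ a : A, tilde a = ldiv a zero) ∧
    (∀ a : A, minus a = rdiv zero a) ∧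
    (∀ a : A, minus (tilde a) = a) ∧
    (∀ a : A, tilde (minus a) = a)

/-- The residuals and the constant `0` are determined by the linear negations. -/
theorem isInFL_iff {A : Type u} [Lattice A] [Monoid A] (tilde minus : A → A) :
    IsInFL tilde minus ↔
      (∀ a b c : A, a * b ≤ c ↔ a ≤ minus (b * tilde c)) ∧
      (∀ a b c : A, a * b ≤ c ↔ b ≤ tilde (minus c * a)) := by
  constructor
  · rintro ⟨z, ldiv, rdiv, hr, hl, ht, hm, hmt, htm⟩
    constructor
    · intro a b c
      rw [hm, ← hr, ← mul_assoc, hr _ _ z, ← hm, hmt]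
    · intro a b c
      rw [ht, ← hl, mul_assoc, hl _ _ z, ← ht, htm]
  · rintro ⟨h1, h2⟩
    have hmt : ∀ a, minus (tilde a) = a := fun a => by
      have h : ∀ x, x ≤ a ↔ x ≤ minus (tilde a) := fun x => by simpa using h1 x 1 a
      exact le_antisymm ((h _).2 le_rfl) ((h _).1 le_rfl)
    have htm : ∀ a, tilde (minus a) = a := fun a => by
      have h : ∀ x, x ≤ a ↔ x ≤ tilde (minus a) := fun x => by simpa using h2 1 x a
      exact le_antisymm ((h _).2 le_rfl) ((h _).1 le_rfl)
    have ht : ∀ x y, x * y ≤ tilde 1 ↔ y ≤ tilde x := fun x y => by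
      simpa [hmt] using h2 x y (tilde 1)
    have hm : ∀ x y, x * y ≤ minus 1 ↔ x ≤ minus y := fun x y => by
      simpa [htm] using h1 x y (minus 1)
    have anti : ∀ x y, x ≤ y → tilde y ≤ tilde x := fun x y hxy => by
      rw [← ht]
      have hy : y * tilde y ≤ tilde 1 := (ht _ _).2 le_rfl
      exact (h1 _ _ _).2 (hxy.trans ((h1 _ _ _).1 hy))
    have anti' : ∀ x y, x ≤ y → minus y ≤ minus x := fun x y hxy => by
      rw [← hm]
      have hy : minus y * y ≤ minus 1 := (hm _ _).2 le_rfl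
      exact (h2 _ _ _).2 (hxy.trans ((h2 _ _ _).1 hy))
    have h01 : tilde 1 = minus 1 := by
      have key : ∀ x, x ≤ tilde 1 ↔ 1 ≤ tilde x := fun x => by simpa using ht x 1
      have key' : ∀ x, x ≤ minus 1 ↔ 1 ≤ tilde x := fun x => by
        constructor
        · intro h
          simpa [htm] using anti _ _ h
        · intro h
          simpa [hmt] using anti' _ _ h
      exact le_antisymm ((key' _).2 ((key _).1 le_rfl)) ((key _).2 ((key' _).1 le_rfl))
    refine ⟨tilde 1, fun a c => tilde (minus c * a), fun c b => minus (b * tilde c), h1, h2,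
      fun a => by simp [hmt], fun a => ?_, hmt, htm⟩
    have h : ∀ x, x ≤ minus a ↔ x ≤ minus (a * tilde (tilde 1)) := fun x => by
      rw [← hm, ← h01, h1]
    exact le_antisymm ((h _).1 le_rfl) ((h _).2 le_rfl)

/-- A distributive involutive FL-algebra, in the signature `⟨∧, ∨, ·, 1, ∼, −⟩`. -/
class DInFLAlgebra (A : Type u) extends DistribLattice A, Monoid A where
  /-- the linear negation `∼a = a \ 0` -/
  tilde : A → A
  /-- the linear negation `−a = 0 / a` -/
  minus : A → A
  isInFL : IsInFL tilde minus

/-- The direct reduct of a DInFL-algebra: same universe, with the operations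
`⟨∧, ∨, ·, →, 1, ∼⟩`, where `a → b = ∼(−b · a)`. -/
def DirectReduct (A : Type u) : Type u := A

instance DirectReduct.instSugiharaSignature (A : Type u) [DInFLAlgebra A] :
    SugiharaSignature (DirectReduct A) where
  min := (fun a b => a ⊓ b : A → A → A)
  max := (fun a b => a ⊔ b : A → A → A)
  mul := (fun a b => a * b : A → A → A)
  one := (1 : A)
  imp := (fun a b => DInFLAlgebra.tilde (DInFLAlgebra.minus b * a) : A → A → A)
  neg := (fun a => DInFLAlgebra.tilde a : A → A)

/-- Isomorphisms of DInFL-algebras. -/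
structure DInFLIso (A B : Type u) [DInFLAlgebra A] [DInFLAlgebra B] extends A ≃ B where
  map_inf : ∀ a b : A, toFun (a ⊓ b) = toFun a ⊓ toFun b
  map_sup : ∀ a b : A, toFun (a ⊔ b) = toFun a ⊔ toFun b
  map_mul : ∀ a b : A, toFun (a * b) = toFun a * toFun b
  map_one : toFun 1 = 1
  map_tilde : ∀ a : A, toFun (DInFLAlgebra.tilde a) = DInFLAlgebra.tilde (toFun a)
  map_minus : ∀ a : A, toFun (DInFLAlgebra.minus a) = DInFLAlgebra.minus (toFun a)

/-- Subalgebras of a DInFL-algebra: subsets closed under all operations. -/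
structure DInFLSubalgebra (A : Type u) [DInFLAlgebra A] extends Submonoid A, Sublattice A where
  tilde_mem : ∀ a ∈ carrier, DInFLAlgebra.tilde a ∈ carrier
  minus_mem : ∀ a ∈ carrier, DInFLAlgebra.minus a ∈ carrier

instance DInFLSubalgebra.instDistribLattice {A : Type u} [DInFLAlgebra A]
    (S : DInFLSubalgebra A) : DistribLattice S.carrier :=
  inferInstanceAs (DistribLattice S.toSublattice)

instance DInFLSubalgebra.instMonoid {A : Type u} [DInFLAlgebra A]
    (S : DInFLSubalgebra A) : Monoid S.carrier :=
  inferInstanceAs (Monoid S.toSubmonoid)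

/-- A subalgebra is a DInFL-algebra with the restricted operations. -/
instance DInFLSubalgebra.instDInFLAlgebra {A : Type u} [DInFLAlgebra A] (S : DInFLSubalgebra A) :
    DInFLAlgebra S.carrier where
  tilde := fun a => ⟨DInFLAlgebra.tilde a.1, S.tilde_mem a.1 a.2⟩
  minus := fun a => ⟨DInFLAlgebra.minus a.1, S.minus_mem a.1 a.2⟩
  isInFL := by
    have h := (isInFL_iff (A := A) _ _).1 DInFLAlgebra.isInFL
    exact (isInFL_iff _ _).2 ⟨fun a b c => h.1 a.1 b.1 c.1, fun a b c => h.2 a.1 b.1 c.1⟩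

/-- The direct product of a family of DInFL-algebras, with componentwise operations. -/
instance instDInFLAlgebraPi {I : Type u} (B : I → Type u) [∀ i, DInFLAlgebra (B i)] :
    DInFLAlgebra (∀ i, B i) where
  tilde := fun a i => DInFLAlgebra.tilde (a i)
  minus := fun a i => DInFLAlgebra.minus (a i)
  isInFL := by
    have h := fun i => (isInFL_iff (A := B i) _ _).1 DInFLAlgebra.isInFL
    exact (isInFL_iff _ _).2
      ⟨fun a b c => forall_congr' fun i => (h i).1 (a i) (b i) (c i),
        fun a b c => forall_congr' fun i => (h i).2 (a i) (b i) (c i)⟩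

/-! ### Classes of DInFL-algebras and the operators `I`, `S`, `P` -/

/-- A bundled DInFL-algebra. -/
structure DInFLAlg : Type (u + 1) where
  /-- the underlying set -/
  carrier : Type u
  [str : DInFLAlgebra carrier]

attribute [instance] DInFLAlg.str

/-- The isomorphic copies of members of `K`. -/
def ClassI (K : DInFLAlg.{u} → Prop) (A : DInFLAlg.{u}) : Prop :=
  ∃ B : DInFLAlg.{u}, K B ∧ Nonempty (DInFLIso A.carrier B.carrier)

/-- The subalgebras of members of `K`. -/
def ClassS (K : DInFLAlg.{u} → Prop) (A : DInFLAlg.{u}) : Prop :=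
  ∃ B : DInFLAlg.{u}, K B ∧ ∃ S : DInFLSubalgebra B.carrier, A = DInFLAlg.mk S.carrier

/-- The direct products of families of members of `K`. -/
def ClassP (K : DInFLAlg.{u} → Prop) (A : DInFLAlg.{u}) : Prop :=
  ∃ (I : Type u) (B : I → DInFLAlg.{u}),
    (∀ i, K (B i)) ∧ A = DInFLAlg.mk (∀ i, (B i).carrier)

/-! ### Full DInFL-algebras of weakening relations -/

/-- `Up(X^∂ × X)`: the binary relations on the poset `X` which are upsets of the product poset
`X^∂ × X`. The order automorphism `α` is a parameter of the type because the DInFL-algebra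
structure depends on it. -/
def UpRel (X : Type u) [PartialOrder X] (_α : X ≃o X) : Type u :=
  {R : SetRel X X // IsUpperSet {p : Xᵒᵈ × X | OrderDual.ofDual p.1 ~[R] p.2}}

namespace UpRel

variable {X : Type u} [PartialOrder X] {α : X ≃o X}

theorem isUpper_iff {R : SetRel X X} :
    IsUpperSet {p : Xᵒᵈ × X | OrderDual.ofDual p.1 ~[R] p.2} ↔
      ∀ ⦃u v x y : X⦄, x ≤ u → v ≤ y → u ~[R] v → x ~[R] y := by
  constructor
  · intro h u v x y hxu hvy huv
    exact h (a := (OrderDual.toDual u, v)) (b := (OrderDual.toDual x, y)) ⟨hxu, hvy⟩ huv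
  · intro h p q hpq hp
    exact h hpq.1 hpq.2 hp

/-- The lattice operations are intersection and union, the order is inclusion. -/
instance : DistribLattice (UpRel X α) where
  le R S := R.1 ⊆ S.1
  le_refl R := subset_rfl
  le_trans R S T h h' := h.trans h'
  le_antisymm R S h h' := Subtype.ext (h.antisymm h')
  inf R S := ⟨R.1 ∩ S.1, R.2.inter S.2⟩
  sup R S := ⟨R.1 ∪ S.1, R.2.union S.2⟩
  inf_le_left R S := Set.inter_subset_left
  inf_le_right R S := Set.inter_subset_right
  le_inf R S T := Set.subset_inter
  le_sup_left R S := Set.subset_union_left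
  le_sup_right R S := Set.subset_union_right
  sup_le R S T := Set.union_subset
  le_sup_inf R S T := (Set.union_inter_distrib_left R.1 S.1 T.1).ge

/-- The multiplication is relational composition, its unit is the order relation of `X`. -/
instance : Monoid (UpRel X α) where
  mul R S := ⟨R.1 ○ S.1, isUpper_iff.2 fun _ _ _ _ hx hy ⟨z, hz, hz'⟩ =>
    ⟨z, isUpper_iff.1 R.2 hx le_rfl hz, isUpper_iff.1 S.2 le_rfl hy hz'⟩⟩
  mul_assoc R S T := Subtype.ext (SetRel.comp_assoc R.1 S.1 T.1)
  one := ⟨{p | p.1 ≤ p.2}, isUpper_iff.2 fun _ _ _ _ hx hy h => hx.trans (h.trans hy)⟩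
  one_mul R := Subtype.ext <| Set.ext fun _ =>
    ⟨fun ⟨_, hz, hz'⟩ => isUpper_iff.1 R.2 hz le_rfl hz', fun h => ⟨_, le_rfl, h⟩⟩
  mul_one R := Subtype.ext <| Set.ext fun _ =>
    ⟨fun ⟨_, hz, hz'⟩ => isUpper_iff.1 R.2 le_rfl hz' hz, fun h => ⟨_, h, le_rfl⟩⟩

/-- The DInFL-algebra of all upsets of `X^∂ × X`, with `∼R = R^{c⌣} ∘ α` and `−R = α ∘ R^{c⌣}`,
where `α` also denotes the graph of the automorphism. -/
instance : DInFLAlgebra (UpRel X α) where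
  tilde R := ⟨(R.1ᶜ).inv ○ Function.graph α, isUpper_iff.2 <| by
    rintro u v x y hx hy ⟨z, hz, rfl⟩
    refine ⟨α.symm y, fun h => hz ?_, α.apply_symm_apply y⟩
    exact isUpper_iff.1 R.2 (α.le_symm_apply.2 hy) hx h⟩
  minus R := ⟨Function.graph α ○ (R.1ᶜ).inv, isUpper_iff.2 <| by
    rintro u v x y hx hy ⟨z, rfl, hz⟩
    exact ⟨α x, rfl, fun h => hz (isUpper_iff.1 R.2 hy (α.monotone hx) h)⟩⟩
  isInFL := by
    refine (isInFL_iff _ _).2 ⟨fun R S T => ?_, fun R S T => ?_⟩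
    · constructor
      · rintro h ⟨x, y⟩ hxy
        refine ⟨α x, rfl, ?_⟩
        rintro ⟨w, hw, w', hw', e⟩
        obtain rfl : w' = x := α.injective e
        exact hw' (h ⟨y, hxy, hw⟩)
      · rintro h ⟨x, y⟩ ⟨z, hxz, hzy⟩
        by_contra hn
        obtain ⟨w, rfl, hw⟩ := h hxz
        exact hw ⟨y, hzy, x, hn, rfl⟩
    · constructor
      · rintro h ⟨x, y⟩ hxy
        refine ⟨α.symm y, ?_, α.apply_symm_apply y⟩
        rintro ⟨w, ⟨v, hv, hw⟩, hw'⟩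
        obtain rfl : y = v := (α.apply_symm_apply y).symm.trans hv
        exact hw (h ⟨x, hw', hxy⟩)
      · rintro h ⟨x, y⟩ ⟨z, hxz, hzy⟩
        by_contra hn
        obtain ⟨w, hw, rfl⟩ := h hzy
        exact hw ⟨x, ⟨α w, rfl, hn⟩, hxz⟩

end UpRel

/-- The class of full DInFL-algebras. -/
def FDInFL (A : DInFLAlg.{u}) : Prop :=
  ∃ (X : Type u) (_ : PartialOrder X) (α : X ≃o X), A = DInFLAlg.mk (UpRel X α)

/-! ### Representability -/

/-- The class of representable DInFL-algebras, `ISP(FDInFL)`. -/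
def RDInFL : DInFLAlg.{u} → Prop := ClassI (ClassS (ClassP FDInFL))

/-- A Sugihara monoid is representable if it is isomorphic to the direct reduct of a representable
DInFL-algebra. -/
def IsRepresentable (A : Type u) [SugiharaMonoid A] : Prop :=
  ∃ B : DInFLAlg.{u}, RDInFL B ∧ Nonempty (SugiharaIso A (DirectReduct B.carrier))

end SugiharaRep

/-!
A Sugihara monoid is a subdirect product of Sugihara chains: prelinearity
(`one_le_imp_sup_imp`) holds because `w = (a · ∼b) ⊓ (b · ∼a)` satisfies
`w = w · w ≤ (a · ∼a) · (b · ∼b) ≤ 0`, so that the quotient by a prime theory is totally ordered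
(`PrimeTheory.quot_total`), and the prime ideal theorem gives enough prime theories to separate
points. Since products and subalgebras are allowed, it remains to represent a single chain `C`
inside one full DInFL-algebra.

In a Sugihara chain the product of two elements is the one of larger absolute value, and their meet
if the absolute values agree. Such a chain is represented on points with a rational coordinate for
each `c ∈ C` above `0 = ∼1`, only finitely many of them nonzero, ordered lexicographically with the
larger `c` more significant. An element `c ≥ 1` is sent to the total preorder that compares only
the coordinates from `c` on, and `∼c` to its strict part. Strict weak orders at two levels compose
to the one at the larger level by density of `ℚ`, while a preorder absorbs the strict orders of
smaller levels because a point can be moved at a single coordinate (`Scale.rel_mul`).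
If `0 < 1` then the automorphism `α` is the identity, and `1`, `0` become `≤`, `<`. If `0 = 1`, a
least significant coordinate in `ℤ` is added and `α` shifts it by `-1`; then `x ≤ y` is equivalent
to `α⁻¹ y ≰ x`, which says that the relation `≤` is its own negation.

The representing map reflects `1 ≤ a`, since a strict order is irreflexive on a nonempty set; by
residuation this suffices for separating points (`exists_isRepHom_not_le`).
-/

namespace SugiharaRep

open SugiharaMonoid (neg imp)
open scoped SetRel

/-! ### Arithmetic of Sugihara monoids -/

section Arithmetic

variable {A : Type u} [SugiharaMonoid A] {a b c d : A}

theorem mul_le_mul_of_le (h : a ≤ b) (h' : c ≤ d) : a * c ≤ b * d := by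
  have mono : ∀ {x y z : A}, y ≤ z → x * y ≤ x * z := fun {x y z} hyz =>
    (SugiharaMonoid.mul_le_iff_le_imp _ _ _).2
      (hyz.trans ((SugiharaMonoid.mul_le_iff_le_imp _ _ _).1 le_rfl))
  calc a * c ≤ a * d := mono h'
    _ = d * a := mul_comm _ _
    _ ≤ d * b := mono h
    _ = b * d := mul_comm _ _

theorem mul_imp_le : a * imp a b ≤ b :=
  (SugiharaMonoid.mul_le_iff_le_imp _ _ _).2 le_rfl

theorem one_le_imp_iff : 1 ≤ imp a b ↔ a ≤ b := by
  rw [← SugiharaMonoid.mul_le_iff_le_imp, mul_one]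

theorem neg_eq_imp : neg a = imp a (neg 1) := by
  rw [SugiharaMonoid.imp_neg_comm]
  refine eq_of_forall_le_iff fun x => ?_
  rw [← SugiharaMonoid.mul_le_iff_le_imp, one_mul]

theorem mul_le_neg_one_iff : a * b ≤ neg 1 ↔ b ≤ neg a := by
  rw [SugiharaMonoid.mul_le_iff_le_imp, ← neg_eq_imp]

theorem le_neg_comm : a ≤ neg b ↔ b ≤ neg a := by
  rw [← mul_le_neg_one_iff, mul_comm, mul_le_neg_one_iff]

theorem neg_le_neg_iff' : neg a ≤ neg b ↔ b ≤ a := by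
  rw [le_neg_comm, SugiharaMonoid.neg_neg]

theorem neg_sup : neg (a ⊔ b) = neg a ⊓ neg b := by
  refine eq_of_forall_le_iff fun x => ?_
  rw [le_inf_iff, le_neg_comm, sup_le_iff, le_neg_comm (a := x), le_neg_comm (a := x)]

theorem imp_eq_neg_mul : imp a b = neg (a * neg b) := by
  refine eq_of_forall_le_iff fun x => ?_
  rw [← SugiharaMonoid.mul_le_iff_le_imp, ← mul_le_neg_one_iff, mul_right_comm, mul_comm,
    mul_comm, mul_comm _ (neg b), mul_le_neg_one_iff, SugiharaMonoid.neg_neg]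

theorem mul_neg_self_le : a * neg a ≤ neg 1 :=
  mul_le_neg_one_iff.2 le_rfl

theorem neg_one_le_one : neg (1 : A) ≤ 1 := by
  have h : neg (1 : A) ≤ neg (neg 1) :=
    mul_le_neg_one_iff.1 (SugiharaMonoid.mul_self _).le
  rwa [SugiharaMonoid.neg_neg] at h

theorem inf_le_mul : a ⊓ b ≤ a * b :=
  (SugiharaMonoid.mul_self (a ⊓ b)).ge.trans (mul_le_mul_of_le inf_le_left inf_le_right)

theorem mul_le_sup : a * b ≤ a ⊔ b :=
  (mul_le_mul_of_le le_sup_left le_sup_right).trans (SugiharaMonoid.mul_self (a ⊔ b)).le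

/-- Excluded middle. -/
theorem one_le_sup_neg : 1 ≤ a ⊔ neg a := by
  rw [← neg_le_neg_iff', neg_sup, SugiharaMonoid.neg_neg, inf_comm]
  exact inf_le_mul.trans mul_neg_self_le

/-- Prelinearity. By involution it says that `w = (a · ∼b) ⊓ (b · ∼a)` lies below `0 = ∼1`, and
`w = w · w` lies below `(a · ∼a) · (b · ∼b) ≤ 0 · 0 = 0`. -/
theorem one_le_imp_sup_imp (a b : A) : 1 ≤ imp a b ⊔ imp b a := by
  rw [← neg_le_neg_iff', neg_sup, imp_eq_neg_mul, imp_eq_neg_mul, SugiharaMonoid.neg_neg,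
    SugiharaMonoid.neg_neg]
  calc a * neg b ⊓ b * neg a ≤ a * neg b * (b * neg a) := inf_le_mul
    _ = a * neg a * (b * neg b) := by
      rw [mul_mul_mul_comm, mul_comm (neg b), mul_mul_mul_comm]
    _ ≤ neg 1 * neg 1 := mul_le_mul_of_le mul_neg_self_le mul_neg_self_le
    _ = neg 1 := SugiharaMonoid.mul_self _

theorem imp_mul_imp_le : imp a b * imp b c ≤ imp a c := by
  rw [← SugiharaMonoid.mul_le_iff_le_imp, ← mul_assoc]
  exact (mul_le_mul_of_le mul_imp_le le_rfl).trans mul_imp_le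

theorem imp_mul_imp_le_imp_mul : imp a b * imp c d ≤ imp (a * c) (b * d) := by
  rw [← SugiharaMonoid.mul_le_iff_le_imp, mul_mul_mul_comm]
  exact mul_le_mul_of_le mul_imp_le mul_imp_le

theorem imp_neg_neg : imp (neg b) (neg a) = imp a b := by
  rw [SugiharaMonoid.imp_neg_comm, SugiharaMonoid.neg_neg]

theorem imp_mul_left : imp (a * b) c = imp b (imp a c) := by
  refine eq_of_forall_le_iff fun x => ?_
  rw [← SugiharaMonoid.mul_le_iff_le_imp, ← SugiharaMonoid.mul_le_iff_le_imp,
    ← SugiharaMonoid.mul_le_iff_le_imp, mul_assoc]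

theorem le_imp_inf : imp a b ⊓ imp a c ≤ imp a (b ⊓ c) := by
  rw [← SugiharaMonoid.mul_le_iff_le_imp]
  exact le_inf ((mul_le_mul_of_le le_rfl inf_le_left).trans mul_imp_le)
    ((mul_le_mul_of_le le_rfl inf_le_right).trans mul_imp_le)

theorem le_sup_imp : imp a c ⊓ imp b c ≤ imp (a ⊔ b) c := by
  rw [← SugiharaMonoid.mul_le_iff_le_imp, mul_comm, SugiharaMonoid.mul_le_iff_le_imp]
  refine sup_le ?_ ?_ <;> rw [← SugiharaMonoid.mul_le_iff_le_imp, mul_comm]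
  · exact (mul_le_mul_of_le le_rfl inf_le_left).trans mul_imp_le
  · exact (mul_le_mul_of_le le_rfl inf_le_right).trans mul_imp_le

end Arithmetic

/-! ### Prime theories and totally ordered quotients -/

/-- A prime theory of a Sugihara monoid: a prime lattice filter that contains `1`. It is closed
under multiplication because `a ⊓ b ≤ a * b`. -/
structure PrimeTheory (A : Type u) [SugiharaMonoid A] where
  /-- the elements of the theory -/
  carrier : Set A
  one_mem : 1 ∈ carrier
  mem_of_le : ∀ {a b : A}, a ≤ b → a ∈ carrier → b ∈ carrier
  inf_mem : ∀ {a b : A}, a ∈ carrier → b ∈ carrier → a ⊓ b ∈ carrier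
  mem_or_mem : ∀ {a b : A}, a ⊔ b ∈ carrier → a ∈ carrier ∨ b ∈ carrier

namespace PrimeTheory

variable {A : Type u} [SugiharaMonoid A]

theorem exists_notMem {a : A} (ha : ¬ 1 ≤ a) : ∃ T : PrimeTheory A, a ∉ T.carrier := by
  have hd : Disjoint (Order.PFilter.principal (1 : A) : Set A) (Order.Ideal.principal a) :=
    Set.disjoint_left.2 fun x hx hx' =>
      ha ((Order.PFilter.mem_principal.1 hx).trans (Order.Ideal.mem_principal.1 hx'))
  obtain ⟨J, hJ, haJ, hJ'⟩ := DistribLattice.prime_ideal_of_disjoint_filter_ideal hd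
  refine ⟨⟨(J : Set A)ᶜ, fun h => ?_, fun {x y} hxy hx hy => hx (J.lower hxy hy),
    fun {x y} hx hy hxy => (hJ.mem_or_mem hxy).elim hx hy, fun {x y} hxy => ?_⟩, fun h => h ?_⟩
  · exact Set.disjoint_left.1 hJ' (Order.PFilter.mem_principal.2 le_rfl) h
  · by_contra! h
    exact hxy (Order.Ideal.sup_mem (not_not.1 h.1) (not_not.1 h.2))
  · exact haJ (Order.Ideal.mem_principal_self)

variable (T : PrimeTheory A) {a b c d : A}

theorem mul_mem (ha : a ∈ T.carrier) (hb : b ∈ T.carrier) : a * b ∈ T.carrier :=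
  T.mem_of_le inf_le_mul (T.inf_mem ha hb)

/-- The entailment preorder of a theory: `a` entails `b` when `a → b` belongs to the theory. -/
def Entails (a b : A) : Prop := imp a b ∈ T.carrier

variable {T}

theorem Entails.of_le (h : a ≤ b) : T.Entails a b :=
  T.mem_of_le (one_le_imp_iff.2 h) T.one_mem

theorem Entails.trans (h : T.Entails a b) (h' : T.Entails b c) : T.Entails a c :=
  T.mem_of_le imp_mul_imp_le (T.mul_mem h h')

theorem Entails.mul (h : T.Entails a b) (h' : T.Entails c d) : T.Entails (a * c) (b * d) :=
  T.mem_of_le imp_mul_imp_le_imp_mul (T.mul_mem h h')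

theorem Entails.neg (h : T.Entails a b) : T.Entails (neg b) (neg a) := by
  rw [Entails, imp_neg_neg]
  exact h

theorem Entails.imp (h : T.Entails b a) (h' : T.Entails c d) :
    T.Entails (imp a c) (imp b d) := by
  rw [imp_eq_neg_mul, imp_eq_neg_mul]
  exact (h.mul h'.neg).neg

theorem Entails.le_inf (h : T.Entails a b) (h' : T.Entails a c) : T.Entails a (b ⊓ c) :=
  T.mem_of_le le_imp_inf (T.inf_mem h h')

theorem Entails.sup_le (h : T.Entails a c) (h' : T.Entails b c) : T.Entails (a ⊔ b) c :=
  T.mem_of_le le_sup_imp (T.inf_mem h h')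

theorem Entails.inf (h : T.Entails a b) (h' : T.Entails c d) : T.Entails (a ⊓ c) (b ⊓ d) :=
  ((Entails.of_le inf_le_left).trans h).le_inf ((Entails.of_le inf_le_right).trans h')

theorem Entails.sup (h : T.Entails a b) (h' : T.Entails c d) : T.Entails (a ⊔ c) (b ⊔ d) :=
  (h.trans (Entails.of_le le_sup_left)).sup_le (h'.trans (Entails.of_le le_sup_right))

variable (T)

theorem entails_total (a b : A) : T.Entails a b ∨ T.Entails b a :=
  T.mem_or_mem (T.mem_of_le (one_le_imp_sup_imp a b) T.one_mem)

/-- Mutual entailment. -/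
def setoid : Setoid A where
  r a b := T.Entails a b ∧ T.Entails b a
  iseqv := ⟨fun _ => ⟨.of_le le_rfl, .of_le le_rfl⟩, fun h => ⟨h.2, h.1⟩,
    fun h h' => ⟨h.1.trans h'.1, h'.2.trans h.2⟩⟩

/-- The quotient of a Sugihara monoid by mutual entailment in a prime theory. -/
def Quot : Type u := Quotient T.setoid

/-- The projection to the quotient. -/
def proj (a : A) : T.Quot := Quotient.mk T.setoid a

variable {T}

theorem ind₃ {p : T.Quot → T.Quot → T.Quot → Prop}
    (h : ∀ a b c, p (T.proj a) (T.proj b) (T.proj c)) (x y z : T.Quot) : p x y z :=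
  Quotient.inductionOn₃ x y z h

theorem proj_eq_proj : T.proj a = T.proj b ↔ T.Entails a b ∧ T.Entails b a :=
  Quotient.eq (r := T.setoid)

instance : Max T.Quot :=
  ⟨Quotient.map₂ (· ⊔ ·) fun _ _ h _ _ h' => ⟨h.1.sup h'.1, h.2.sup h'.2⟩⟩

instance : Min T.Quot :=
  ⟨Quotient.map₂ (· ⊓ ·) fun _ _ h _ _ h' => ⟨h.1.inf h'.1, h.2.inf h'.2⟩⟩

instance : Mul T.Quot :=
  ⟨Quotient.map₂ (· * ·) fun _ _ h _ _ h' => ⟨h.1.mul h'.1, h.2.mul h'.2⟩⟩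

instance : One T.Quot := ⟨T.proj 1⟩

instance : LE T.Quot :=
  ⟨Quotient.lift₂ T.Entails fun _ _ _ _ h h' => propext
    ⟨fun k => h.2.trans (k.trans h'.1), fun k => h.1.trans (k.trans h'.2)⟩⟩

instance : DistribLattice T.Quot where
  le_refl := Quotient.ind fun _ => Entails.of_le le_rfl
  le_trans := ind₃ fun _ _ _ => Entails.trans
  le_antisymm := Quotient.ind₂ fun _ _ h h' => proj_eq_proj.2 ⟨h, h'⟩
  sup := (· ⊔ ·)
  le_sup_left := Quotient.ind₂ fun _ _ => Entails.of_le le_sup_left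
  le_sup_right := Quotient.ind₂ fun _ _ => Entails.of_le le_sup_right
  sup_le := ind₃ fun _ _ _ => Entails.sup_le
  inf := (· ⊓ ·)
  inf_le_left := Quotient.ind₂ fun _ _ => Entails.of_le inf_le_left
  inf_le_right := Quotient.ind₂ fun _ _ => Entails.of_le inf_le_right
  le_inf := ind₃ fun _ _ _ => Entails.le_inf
  le_sup_inf := ind₃ fun _ _ _ => Entails.of_le le_sup_inf

instance : SugiharaMonoid T.Quot where
  mul_assoc := ind₃ fun _ _ _ => congrArg T.proj (mul_assoc _ _ _)
  mul_comm := Quotient.ind₂ fun _ _ => congrArg T.proj (mul_comm _ _)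
  one_mul := Quotient.ind fun _ => congrArg T.proj (one_mul _)
  mul_one := Quotient.ind fun _ => congrArg T.proj (mul_one _)
  imp := Quotient.map₂ imp fun _ _ h _ _ h' => ⟨h.2.imp h'.1, h.1.imp h'.2⟩
  neg := Quotient.map neg fun _ _ h => ⟨h.2.neg, h.1.neg⟩
  mul_le_iff_le_imp := ind₃ fun a b c => by
    have h : T.Entails (a * b) c ↔ T.Entails b (imp a c) := by rw [Entails, imp_mul_left, Entails]
    exact h
  mul_self := Quotient.ind fun _ => congrArg T.proj (SugiharaMonoid.mul_self _)
  neg_neg := Quotient.ind fun _ => congrArg T.proj (SugiharaMonoid.neg_neg _)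
  imp_neg_comm := Quotient.ind₂ fun _ _ => congrArg T.proj (SugiharaMonoid.imp_neg_comm _ _)

theorem quot_total : ∀ x y : T.Quot, x ≤ y ∨ y ≤ x := Quotient.ind₂ T.entails_total

theorem proj_le_proj : T.proj a ≤ T.proj b ↔ imp a b ∈ T.carrier := Iff.rfl

end PrimeTheory

/-! ### Multiplication in Sugihara chains -/

section Chain

variable {C : Type u} [SugiharaMonoid C] {a b : C}

theorem one_le_neg_of_not_one_le (ht : ∀ a b : C, a ≤ b ∨ b ≤ a) (ha : ¬ 1 ≤ a) :
    1 ≤ neg a := by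
  rcases ht a (neg a) with h | h
  · exact one_le_sup_neg.trans (sup_le h le_rfl)
  · exact absurd (one_le_sup_neg.trans (sup_le le_rfl h)) ha

theorem mul_eq_sup (ha : 1 ≤ a) (hb : 1 ≤ b) : a * b = a ⊔ b := by
  refine le_antisymm mul_le_sup (sup_le ?_ ?_)
  · simpa using mul_le_mul_of_le (le_refl a) hb
  · simpa using mul_le_mul_of_le ha (le_refl b)

theorem mul_eq_inf (ha : a ≤ 1) (hb : b ≤ 1) : a * b = a ⊓ b := by
  refine le_antisymm (le_inf ?_ ?_) inf_le_mul
  · simpa using mul_le_mul_of_le (le_refl a) hb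
  · simpa using mul_le_mul_of_le ha (le_refl b)

theorem mul_eq_right (ha : 1 ≤ a) (hab : a ≤ neg b) : a * b = b := by
  refine le_antisymm ?_ ?_
  · rw [← SugiharaMonoid.neg_neg b, ← mul_le_neg_one_iff, SugiharaMonoid.neg_neg, ← mul_assoc,
      mul_comm]
    refine (mul_le_mul_of_le le_rfl (mul_le_mul_of_le le_rfl hab)).trans ?_
    rw [SugiharaMonoid.mul_self]
    exact mul_neg_self_le
  · simpa using mul_le_mul_of_le ha (le_refl b)

theorem mul_eq_left (ht : ∀ a b : C, a ≤ b ∨ b ≤ a) (hb : b ≤ 1) (hab : ¬ a ≤ neg b) :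
    a * b = a := by
  refine le_antisymm ?_ ?_
  · simpa using mul_le_mul_of_le (le_refl a) hb
  · have hx : b * neg (a * b) ≤ neg a := by
      rw [← mul_le_neg_one_iff, ← mul_assoc]
      exact mul_neg_self_le
    -- one of the two factors on the left is below `∼a`, and it cannot be `b`
    rw [← neg_le_neg_iff']
    rcases ht b (neg (a * b)) with h | h
    · refine absurd ?_ hab
      rw [le_neg_comm]
      exact (le_inf le_rfl h).trans (inf_le_mul.trans hx)
    · exact (le_inf h le_rfl).trans (inf_le_mul.trans hx)

end Chain

/-! ### Representing a chain by a scale of strict weak orders -/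

/-- A scale on the poset `X` with automorphism `α`, indexed by the Sugihara chain `C`: for every
`c ≥ 1` a strict weak order `lt c`, coarser for larger `c` and equal to `<` for `c = 1`. Density and
the jumps are required only for `c` with `∼c < 1`, that is, for every `c ≥ 1` except for `c = 1` in
case `∼1 = 1`; in this exceptional case `α` sends every point to its predecessor. -/
structure Scale (C : Type u) [SugiharaMonoid C] (X : Type u) [PartialOrder X] (α : X ≃o X) where
  /-- the strict weak order at level `c` -/
  lt : C → X → X → Prop
  lt_one : ∀ {x y : X}, lt 1 x y ↔ x < y
  anti : ∀ {c d : C} {x y : X}, 1 ≤ c → c ≤ d → lt d x y → lt c x y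
  asymm : ∀ {c : C} {x y : X}, lt c x y → ¬ lt c y x
  lt_or_lt : ∀ {c : C} {x y : X}, lt c x y → ∀ z, lt c x z ∨ lt c z y
  map_left : ∀ {c : C} {x y : X}, neg c < 1 → (lt c (α x) y ↔ lt c x y)
  map_right : ∀ {c : C} {x y : X}, neg c < 1 → (lt c x (α y) ↔ lt c x y)
  pred : ∀ {x y : X}, neg (1 : C) = 1 → (lt 1 x y ↔ ¬ lt 1 (α y) x)
  dense : ∀ {c : C} {x y : X}, neg c < 1 → lt c x y → ∃ z, lt c x z ∧ lt c z y
  jump_up : ∀ {c d : C} (x : X), neg c < 1 → c < d → ∃ z, lt c x z ∧ ¬ lt d x z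
  jump_down : ∀ {c d : C} (x : X), neg c < 1 → c < d → ∃ z, lt c z x ∧ ¬ lt d z x

namespace Scale

variable {C : Type u} [SugiharaMonoid C] {X : Type u} [PartialOrder X] {α : X ≃o X}
  (s : Scale C X α) {a b c d : C} {x y z : X}

theorem irrefl : ¬ s.lt c x x := fun h => s.asymm h h

theorem lt_of_le_of_lt (hc : 1 ≤ c) (h : x ≤ y) (h' : s.lt c y z) : s.lt c x z :=
  (s.lt_or_lt h' x).resolve_left fun hyx =>
    (s.lt_one.1 (s.anti le_rfl hc hyx)).not_ge h

theorem lt_of_lt_of_le (hc : 1 ≤ c) (h : s.lt c x y) (h' : y ≤ z) : s.lt c x z :=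
  (s.lt_or_lt h z).resolve_right fun hzy =>
    (s.lt_one.1 (s.anti le_rfl hc hzy)).not_ge h'

open Classical in
/-- The relation representing `a`: the total preorder "not `>` at level `a`" for `a ≥ 1`, and the
strict weak order at level `∼a` otherwise. -/
def relProp (a : C) (x y : X) : Prop := if 1 ≤ a then ¬ s.lt a y x else s.lt (neg a) x y

theorem relProp_of_one_le (ha : 1 ≤ a) : s.relProp a x y ↔ ¬ s.lt a y x := by
  rw [relProp, if_pos ha]

theorem relProp_of_not_one_le (ha : ¬ 1 ≤ a) : s.relProp a x y ↔ s.lt (neg a) x y := by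
  rw [relProp, if_neg ha]

variable (ht : ∀ a b : C, a ≤ b ∨ b ≤ a)

/-- The weakening relation representing an element of a Sugihara chain. -/
def rel (a : C) : UpRel X α :=
  ⟨{p | s.relProp a p.1 p.2}, UpRel.isUpper_iff.2 fun u v _ _ hxu hvy => by
    change s.relProp a u v → s.relProp a _ _
    by_cases ha : 1 ≤ a
    · rw [s.relProp_of_one_le ha, s.relProp_of_one_le ha]
      exact fun h h' => h (s.lt_of_le_of_lt ha hvy (s.lt_of_lt_of_le ha h' hxu))
    · rw [s.relProp_of_not_one_le ha, s.relProp_of_not_one_le ha]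
      have hn := one_le_neg_of_not_one_le ht ha
      exact fun h => s.lt_of_le_of_lt hn hxu (s.lt_of_lt_of_le hn h hvy)⟩

theorem rel_le_rel_of_le (hab : a ≤ b) : s.rel ht a ≤ s.rel ht b := by
  rintro ⟨x, y⟩
  change s.relProp a x y → s.relProp b x y
  by_cases hb : 1 ≤ b
  · rw [s.relProp_of_one_le hb]
    by_cases ha : 1 ≤ a
    · rw [s.relProp_of_one_le ha]
      exact fun h h' => h (s.anti ha hab h')
    · rw [s.relProp_of_not_one_le ha]
      exact fun h h' => s.asymm (s.anti le_rfl (one_le_neg_of_not_one_le ht ha) h)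
        (s.anti le_rfl hb h')
  · rw [s.relProp_of_not_one_le hb, s.relProp_of_not_one_le fun ha => hb (ha.trans hab)]
    exact s.anti (one_le_neg_of_not_one_le ht hb) (neg_le_neg_iff'.2 hab)

theorem rel_inf : s.rel ht (a ⊓ b) = s.rel ht a ⊓ s.rel ht b := by
  rcases ht a b with h | h
  · rw [inf_eq_left.2 h, inf_eq_left.2 (s.rel_le_rel_of_le ht h)]
  · rw [inf_eq_right.2 h, inf_eq_right.2 (s.rel_le_rel_of_le ht h)]

theorem rel_sup : s.rel ht (a ⊔ b) = s.rel ht a ⊔ s.rel ht b := by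
  rcases ht a b with h | h
  · rw [sup_eq_right.2 h, sup_eq_right.2 (s.rel_le_rel_of_le ht h)]
  · rw [sup_eq_left.2 h, sup_eq_left.2 (s.rel_le_rel_of_le ht h)]

theorem rel_ext_iff {R : UpRel X α} :
    s.rel ht a = R ↔ ∀ x y, s.relProp a x y ↔ x ~[R.1] y :=
  ⟨fun h _ _ => h ▸ Iff.rfl, fun h => Subtype.ext (Set.ext fun p => h p.1 p.2)⟩

theorem rel_one (hX : ∀ x y : X, x ≤ y ∨ y ≤ x) : s.rel ht 1 = 1 := by
  rw [s.rel_ext_iff]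
  intro x y
  rw [s.relProp_of_one_le le_rfl, s.lt_one]
  change _ ↔ x ≤ y
  exact ⟨fun h => (hX x y).elim id fun h' => (h'.eq_of_not_lt h).ge, fun h => h.not_gt⟩

theorem rel_mul : s.rel ht (a * b) = s.rel ht a * s.rel ht b := by
  have neg_neg_lt : ∀ {c : C}, ¬ 1 ≤ c → neg (neg c) < 1 := fun {c} hc => by
    rw [SugiharaMonoid.neg_neg]
    exact lt_of_le_not_ge ((ht c 1).resolve_right hc) hc
  rw [s.rel_ext_iff]
  intro x y
  change _ ↔ ∃ z, s.relProp a x z ∧ s.relProp b z y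
  by_cases ha : 1 ≤ a <;> by_cases hb : 1 ≤ b
  · simp only [mul_eq_sup ha hb, s.relProp_of_one_le ha, s.relProp_of_one_le hb]
    rw [s.relProp_of_one_le (ha.trans le_sup_left)]
    rcases ht a b with h | h
    · rw [sup_eq_right.2 h]
      refine ⟨fun hxy => ⟨x, s.irrefl, hxy⟩, ?_⟩
      rintro ⟨z, hz, hz'⟩ hyx
      exact hz (s.anti ha h ((s.lt_or_lt hyx z).resolve_left hz'))
    · rw [sup_eq_left.2 h]
      refine ⟨fun hxy => ⟨y, hxy, s.irrefl⟩, ?_⟩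
      rintro ⟨z, hz, hz'⟩ hyx
      exact hz' (s.anti hb h ((s.lt_or_lt hyx z).resolve_right hz))
  · have hb' := one_le_neg_of_not_one_le ht hb
    simp only [s.relProp_of_one_le ha, s.relProp_of_not_one_le hb]
    by_cases hab : a ≤ neg b
    · rw [mul_eq_right ha hab, s.relProp_of_not_one_le hb]
      refine ⟨fun hxy => ⟨x, s.irrefl, hxy⟩, ?_⟩
      rintro ⟨z, hz, hz'⟩
      exact (s.lt_or_lt hz' x).resolve_left fun hzx => hz (s.anti ha hab hzx)
    · rw [mul_eq_left ht ((ht b 1).resolve_right hb) hab, s.relProp_of_one_le ha]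
      have hlt : neg b < a := lt_of_le_not_ge ((ht _ _).resolve_left hab) hab
      constructor
      · intro hxy
        obtain ⟨z, hz, hz'⟩ := s.jump_down y (neg_neg_lt hb) hlt
        exact ⟨z, fun hzx => (s.lt_or_lt hzx y).elim hz' hxy, hz⟩
      · rintro ⟨z, hz, hz'⟩ hyx
        exact (s.lt_or_lt hyx z).elim (fun h => s.asymm (s.anti hb' hlt.le h) hz') hz
  · have ha' := one_le_neg_of_not_one_le ht ha
    simp only [s.relProp_of_one_le hb, s.relProp_of_not_one_le ha]
    by_cases hab : b ≤ neg a
    · rw [mul_comm, mul_eq_right hb hab, s.relProp_of_not_one_le ha]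
      refine ⟨fun hxy => ⟨y, hxy, s.irrefl⟩, ?_⟩
      rintro ⟨z, hz, hz'⟩
      exact (s.lt_or_lt hz y).resolve_right fun hyz => hz' (s.anti hb hab hyz)
    · rw [mul_comm, mul_eq_left ht ((ht a 1).resolve_right ha) hab, s.relProp_of_one_le hb]
      have hlt : neg a < b := lt_of_le_not_ge ((ht _ _).resolve_left hab) hab
      constructor
      · intro hxy
        obtain ⟨z, hz, hz'⟩ := s.jump_up x (neg_neg_lt ha) hlt
        exact ⟨z, hz, fun hyz => (s.lt_or_lt hyz x).elim hxy hz'⟩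
      · rintro ⟨z, hz, hz'⟩ hyx
        exact (s.lt_or_lt hyx z).elim hz' (fun h => s.asymm (s.anti ha' hlt.le h) hz)
  · have ha' := one_le_neg_of_not_one_le ht ha
    have hb' := one_le_neg_of_not_one_le ht hb
    simp only [mul_eq_inf ((ht a 1).resolve_right ha) ((ht b 1).resolve_right hb),
      s.relProp_of_not_one_le ha, s.relProp_of_not_one_le hb]
    rw [s.relProp_of_not_one_le fun h => ha (h.trans inf_le_left)]
    rcases ht a b with h | h
    · rw [inf_eq_left.2 h]
      constructor
      · intro hxy
        obtain ⟨z, hz, hz'⟩ := s.dense (neg_neg_lt ha) hxy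
        exact ⟨z, hz, s.anti hb' (neg_le_neg_iff'.2 h) hz'⟩
      · rintro ⟨z, hz, hz'⟩
        exact (s.lt_or_lt hz y).resolve_right fun hyz =>
          s.asymm (s.anti hb' (neg_le_neg_iff'.2 h) hyz) hz'
    · rw [inf_eq_right.2 h]
      constructor
      · intro hxy
        obtain ⟨z, hz, hz'⟩ := s.dense (neg_neg_lt hb) hxy
        exact ⟨z, s.anti ha' (neg_le_neg_iff'.2 h) hz, hz'⟩
      · rintro ⟨z, hz, hz'⟩
        exact (s.lt_or_lt hz' x).resolve_left fun hzx =>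
          s.asymm (s.anti ha' (neg_le_neg_iff'.2 h) hzx) hz

/-- Both linear negations of `UpRel X α` restrict to the involution of the chain. -/
theorem relProp_neg_iff (ht : ∀ a b : C, a ≤ b ∨ b ≤ a) :
    (s.relProp (neg a) x (α y) ↔ ¬ s.relProp a y x) ∧
      (s.relProp (neg a) x y ↔ ¬ s.relProp a y (α x)) := by
  by_cases ha : 1 ≤ a
  · rw [s.relProp_of_one_le ha, s.relProp_of_one_le ha, not_not, not_not]
    by_cases hn : 1 ≤ neg a
    · obtain rfl : a = 1 := le_antisymm ((le_neg_comm.1 hn).trans neg_one_le_one) ha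
      have h1 : neg (1 : C) = 1 := le_antisymm neg_one_le_one hn
      rw [h1, s.relProp_of_one_le le_rfl, s.relProp_of_one_le le_rfl]
      exact ⟨(s.pred h1).symm, (iff_not_comm.1 (s.pred h1)).symm⟩
    · have hn' : neg a < 1 := lt_of_le_not_ge ((ht _ _).resolve_right hn) hn
      rw [s.relProp_of_not_one_le hn, s.relProp_of_not_one_le hn, SugiharaMonoid.neg_neg,
        s.map_right hn', s.map_left hn']
      exact ⟨Iff.rfl, Iff.rfl⟩
  · have hn := one_le_neg_of_not_one_le ht ha
    have ha' : neg (neg a) < 1 := by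
      rw [SugiharaMonoid.neg_neg]
      exact lt_of_le_not_ge ((ht _ _).resolve_right ha) ha
    rw [s.relProp_of_one_le hn, s.relProp_of_one_le hn, s.relProp_of_not_one_le ha,
      s.relProp_of_not_one_le ha, s.map_left ha', s.map_right ha']
    exact ⟨Iff.rfl, Iff.rfl⟩

theorem rel_neg : s.rel ht (neg a) = DInFLAlgebra.tilde (s.rel ht a) := by
  rw [s.rel_ext_iff]
  intro x y
  change _ ↔ ∃ z, ¬ s.relProp a z x ∧ α z = y
  constructor
  · intro h
    refine ⟨α.symm y, (s.relProp_neg_iff ht).1.1 ?_, α.apply_symm_apply y⟩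
    rwa [α.apply_symm_apply]
  · rintro ⟨z, hz, rfl⟩
    exact (s.relProp_neg_iff ht).1.2 hz

theorem rel_neg' : s.rel ht (neg a) = DInFLAlgebra.minus (s.rel ht a) := by
  rw [s.rel_ext_iff]
  intro x y
  change _ ↔ ∃ z, α x = z ∧ ¬ s.relProp a y z
  rw [(s.relProp_neg_iff ht).2]
  simp

theorem one_le_of_one_le_rel [Nonempty X] (h : 1 ≤ s.rel ht a) : 1 ≤ a := by
  by_contra ha
  obtain ⟨x⟩ := ‹Nonempty X›
  have hx : s.relProp a x x := h (show (x, x) ∈ (1 : UpRel X α).1 from le_refl x)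
  exact s.irrefl ((s.relProp_of_not_one_le ha).1 hx)

end Scale

/-! ### The lexicographic scale of a Sugihara chain -/

section LeadLT

variable {P : Type u} [PartialOrder P] {U V : Set P} {f g : P →₀ ℚ}

/-- `f` is smaller than `g` at a coordinate in `U` above which they agree. -/
def LeadLT (U : Set P) (f g : P →₀ ℚ) : Prop :=
  ∃ r ∈ U, f r < g r ∧ ∀ t, r < t → f t = g t

theorem LeadLT.mono (h : U ⊆ V) (hfg : LeadLT U f g) : LeadLT V f g := by
  obtain ⟨r, hr, h'⟩ := hfg
  exact ⟨r, h hr, h'⟩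

theorem exists_maximal_ne {r : P} (h : f r ≠ g r) :
    ∃ t, r ≤ t ∧ f t ≠ g t ∧ ∀ t', t < t' → f t' = g t' := by
  classical
  obtain ⟨t, hrt, ht⟩ := (f - g).support.exists_le_maximal (a := r)
    (by simpa [sub_eq_zero] using h)
  have hne : f t ≠ g t := by simpa [sub_eq_zero] using ht.1
  refine ⟨t, hrt, hne, fun t' htt' => ?_⟩
  by_contra h'
  exact htt'.not_ge (ht.2 (by simpa [sub_eq_zero] using h') htt'.le)

theorem leadLT_total (h : f ≠ g) : LeadLT Set.univ f g ∨ LeadLT Set.univ g f := by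
  obtain ⟨r, hr⟩ := Finsupp.ne_iff.1 h
  obtain ⟨t, -, ht, ht'⟩ := exists_maximal_ne hr
  rcases ht.lt_or_gt with h | h
  · exact .inl ⟨t, trivial, h, ht'⟩
  · exact .inr ⟨t, trivial, h, fun t' h' => (ht' t' h').symm⟩

theorem LeadLT.irrefl : ¬ LeadLT U f f := fun ⟨_, _, h, _⟩ => h.false

theorem LeadLT.asymm (hP : ∀ r t : P, r ≤ t ∨ t ≤ r) (h : LeadLT U f g) :
    ¬ LeadLT V g f := by
  rintro ⟨t, -, ht, ht'⟩
  obtain ⟨r, -, hr, hr'⟩ := h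
  rcases eq_or_ne r t with rfl | hne
  · exact ht.asymm hr
  · rcases hP r t with h | h
    · exact ht.ne' (hr' t (lt_of_le_of_ne h hne))
    · exact hr.ne' (ht' r (lt_of_le_of_ne h hne.symm))

theorem LeadLT.lt_or_lt (hU : IsUpperSet U) (h : LeadLT U f g) (k : P →₀ ℚ) :
    LeadLT U f k ∨ LeadLT U k g := by
  obtain ⟨r, hrU, hr, hr'⟩ := h
  by_cases hk : ∀ t, r ≤ t → f t = k t
  · exact .inr ⟨r, hrU, hk r le_rfl ▸ hr, fun t ht => (hk t ht.le).symm.trans (hr' t ht)⟩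
  · push Not at hk
    obtain ⟨t₀, ht₀, hne⟩ := hk
    obtain ⟨t, htt, ht, ht'⟩ := exists_maximal_ne hne
    have hrt := ht₀.trans htt
    rcases ht.lt_or_gt with h | h
    · exact .inl ⟨t, hU hrt hrU, h, ht'⟩
    · have hfg : f t ≤ g t := by
        rcases hrt.eq_or_lt with rfl | hlt
        exacts [hr.le, (hr' t hlt).le]
      exact .inr ⟨t, hU hrt hrU, h.trans_le hfg,
        fun t' h' => (ht' t' h').symm.trans (hr' t' (hrt.trans_lt h'))⟩

theorem leadLT_add_single {r : P} (hr : r ∈ U) {q : ℚ} (hq : 0 < q) :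
    LeadLT U f (f + Finsupp.single r q) := by
  exact ⟨r, hr, by simpa using hq, fun t ht => by simp [ht.ne]⟩

theorem not_leadLT_add_single {r : P} (hr : r ∉ U) {q : ℚ} :
    ¬ LeadLT U f (f + Finsupp.single r q) := by
  rintro ⟨t, ht, h, -⟩
  have hne : r ≠ t := fun h => hr (h ▸ ht)
  simp [hne] at h

theorem LeadLT.exists_between (h : LeadLT U f g) : ∃ k, LeadLT U f k ∧ LeadLT U k g := by
  obtain ⟨r, hrU, hr, hr'⟩ := h
  refine ⟨f + Finsupp.single r ((g r - f r) / 2), leadLT_add_single hrU (by linarith),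
    r, hrU, ?_, fun t ht => ?_⟩
  · simp only [Finsupp.add_apply, Finsupp.single_eq_same]
    linarith
  · simp [ht.ne, hr' t ht]

end LeadLT

/-- The coordinates of the points representing the chain `C`: the elements `c` above `0 = ∼1`. -/
abbrev Coord (C : Type u) [SugiharaMonoid C] : Type u := {c : C // neg c < 1}

/-- Points of the lexicographic scale. The most significant coordinates are the largest ones in
`Coord C`, the least significant one is the coordinate in `Y`. -/
@[ext] structure Point (C : Type u) [SugiharaMonoid C] (Y : Type) : Type u where
  /-- the rational coordinates -/
  fst : Coord C →₀ ℚ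
  /-- the last coordinate -/
  snd : Y

namespace Point

variable {C : Type u} [SugiharaMonoid C] {Y : Type} [LinearOrder Y] {c d : C} {x y : Point C Y}

/-- The strict weak order at level `c`: points are compared by their coordinates that are at least
`c`, and for `c = 1` finally also by the coordinate in `Y`. -/
def Lt (c : C) (x y : Point C Y) : Prop :=
  LeadLT {r : Coord C | c ≤ r.1} x.fst y.fst ∨ c ≤ 1 ∧ x.fst = y.fst ∧ x.snd < y.snd

theorem one_le_coord (ht : ∀ a b : C, a ≤ b ∨ b ≤ a) {r : C} (hr : neg r < 1) : 1 ≤ r := by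
  have h := one_le_neg_of_not_one_le ht hr.not_ge
  rwa [SugiharaMonoid.neg_neg] at h

theorem isUpperSet_coord : IsUpperSet {r : Coord C | c ≤ r.1} :=
  fun _ _ h h' => le_trans (α := C) h' h

theorem coord_total (ht : ∀ a b : C, a ≤ b ∨ b ≤ a) (r t : Coord C) : r ≤ t ∨ t ≤ r :=
  ht r.1 t.1

theorem Lt.anti (hcd : c ≤ d) (h : Lt d x y) : Lt c x y := by
  rcases h with h | ⟨h, h'⟩
  · exact .inl (h.mono fun _ hr => le_trans (α := C) hcd hr)
  · exact .inr ⟨hcd.trans h, h'⟩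

theorem Lt.asymm (ht : ∀ a b : C, a ≤ b ∨ b ≤ a) (h : Lt c x y) : ¬ Lt d y x := by
  rintro (h' | ⟨-, h', h''⟩) <;> rcases h with h | ⟨-, e, h⟩
  · exact h.asymm (coord_total ht) h'
  · exact LeadLT.irrefl (e ▸ h')
  · exact LeadLT.irrefl (h' ▸ h)
  · exact h.asymm h''

theorem Lt.lt_or_lt (ht : ∀ a b : C, a ≤ b ∨ b ≤ a) (h : Lt c x y) (z : Point C Y) :
    Lt c x z ∨ Lt c z y := by
  rcases h with h | ⟨hc, e, h⟩
  · exact (h.lt_or_lt isUpperSet_coord z.fst).imp .inl .inl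
  · by_cases hz : x.fst = z.fst
    · rcases lt_or_ge x.snd z.snd with h' | h'
      · exact .inl (.inr ⟨hc, hz, h'⟩)
      · exact .inr (.inr ⟨hc, hz.symm.trans e, h'.trans_lt h⟩)
    · have hsub : Set.univ ⊆ {r : Coord C | c ≤ r.1} :=
        fun r _ => hc.trans (one_le_coord ht r.2)
      rcases leadLT_total hz with h' | h'
      · exact .inl (.inl (h'.mono hsub))
      · exact .inr (.inl (e ▸ h'.mono hsub))

theorem lt_total (ht : ∀ a b : C, a ≤ b ∨ b ≤ a) (h : x ≠ y) : Lt 1 x y ∨ Lt 1 y x := by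
  by_cases e : x.fst = y.fst
  · have hne : x.snd ≠ y.snd := fun e' => h (Point.ext e e')
    exact hne.lt_or_gt.imp (fun h' => .inr ⟨le_rfl, e, h'⟩) fun h' => .inr ⟨le_rfl, e.symm, h'⟩
  · have hsub : Set.univ ⊆ {r : Coord C | 1 ≤ r.1} := fun r _ => one_le_coord ht r.2
    exact (leadLT_total e).imp (fun h' => .inl (h'.mono hsub)) fun h' => .inl (h'.mono hsub)

/-- The lexicographic order of the points. -/
abbrev partialOrder (ht : ∀ a b : C, a ≤ b ∨ b ≤ a) (Y : Type) [LinearOrder Y] :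
    PartialOrder (Point C Y) where
  le x y := ¬ Lt 1 y x
  lt := Lt 1
  le_refl _ h := h.asymm ht h
  le_trans _ y _ h h' h'' := (h''.lt_or_lt ht y).elim h' h
  lt_iff_le_not_ge _ _ := ⟨fun h => ⟨h.asymm ht, not_not.2 h⟩, fun h => not_not.1 h.2⟩
  le_antisymm _ _ h h' := by
    by_contra hne
    exact (lt_total ht hne).elim h' h

/-- The automorphism of the points that applies `β` to the last coordinate. -/
def automorphism (ht : ∀ a b : C, a ≤ b ∨ b ≤ a) (β : Y ≃o Y) :
    letI := partialOrder ht Y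
    Point C Y ≃o Point C Y :=
  letI := partialOrder ht Y
  { toFun := fun x => ⟨x.fst, β x.snd⟩
    invFun := fun x => ⟨x.fst, β.symm x.snd⟩
    left_inv := fun x => by simp
    right_inv := fun x => by simp
    map_rel_iff' := fun {x y} => by
      change ¬ Lt 1 _ _ ↔ ¬ Lt 1 _ _
      simp [Lt] }

/-- The lexicographic scale of a Sugihara chain. The last coordinate is trivial if `∼1 < 1`; if
`∼1 = 1` then it makes `β` send every point to its predecessor. -/
def scale (ht : ∀ a b : C, a ≤ b ∨ b ≤ a) (β : Y ≃o Y) (heven : neg (1 : C) < 1 → Subsingleton Y)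
    (hodd : neg (1 : C) = 1 → ∀ m n : Y, m < n ↔ m ≤ β n) :
    letI := partialOrder ht Y
    Scale C (Point C Y) (automorphism ht β) :=
  letI := partialOrder ht Y
  have key : ∀ {c : C} {x y : Point C Y}, neg c < 1 →
      (Lt c x y ↔ LeadLT {r : Coord C | c ≤ r.1} x.fst y.fst) := fun {c x y} hc => by
    refine ⟨fun h => h.resolve_right ?_, .inl⟩
    rintro ⟨h1, -, hlt⟩
    obtain rfl : c = 1 := le_antisymm h1 (one_le_coord ht hc)
    have := heven hc
    exact hlt.ne (Subsingleton.elim _ _)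
  { lt := Lt
    lt_one := Iff.rfl
    anti := fun _ => Lt.anti
    asymm := Lt.asymm ht
    lt_or_lt := Lt.lt_or_lt ht
    map_left := fun hc => by rw [key hc, key hc]; rfl
    map_right := fun hc => by rw [key hc, key hc]; rfl
    pred := fun {x y} h => by
      have hy : (automorphism ht β y).fst = y.fst := rfl
      have hy' : (automorphism ht β y).snd = β y.snd := rfl
      constructor
      · rintro (h' | ⟨-, e, h'⟩) (h'' | ⟨-, e', h''⟩)
        · exact h'.asymm (coord_total ht) h''
        · rw [← e', hy] at h'
          exact LeadLT.irrefl h'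
        · rw [e, hy] at h''
          exact LeadLT.irrefl h''
        · exact h''.not_ge ((hodd h _ _).1 h')
      · intro h'
        by_cases e : x.fst = y.fst
        · refine .inr ⟨le_rfl, e, (hodd h _ _).2 (not_lt.1 fun h'' => h' ?_)⟩
          exact .inr ⟨le_rfl, e.symm, h''⟩
        · have hsub : Set.univ ⊆ {r : Coord C | 1 ≤ r.1} := fun r _ => one_le_coord ht r.2
          refine .inl (((leadLT_total e).resolve_right fun h'' => h' ?_).mono hsub)
          exact .inl (h''.mono hsub)
    dense := fun {c x y} hc h => by
      obtain ⟨k, hk, hk'⟩ := ((key hc).1 h).exists_between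
      exact ⟨⟨k, x.snd⟩, .inl hk, .inl hk'⟩
    jump_up := fun {c d} x hc hcd => by
      refine ⟨⟨x.fst + Finsupp.single ⟨c, hc⟩ 1, x.snd⟩,
        .inl (leadLT_add_single (r := (⟨c, hc⟩ : Coord C)) (Set.mem_ofPred.2 le_rfl) one_pos), ?_⟩
      rintro (h | ⟨h, -⟩)
      · exact not_leadLT_add_single (r := (⟨c, hc⟩ : Coord C)) (fun h => hcd.not_ge h) h
      · exact hcd.not_ge (h.trans (one_le_coord ht hc))
    jump_down := fun {c d} x hc hcd => by
      obtain ⟨f, hf⟩ : ∃ f, x.fst = f + Finsupp.single (⟨c, hc⟩ : Coord C) 1 :=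
        ⟨x.fst - Finsupp.single ⟨c, hc⟩ 1, (sub_add_cancel _ _).symm⟩
      refine ⟨⟨f, x.snd⟩, .inl (hf ▸
        leadLT_add_single (r := (⟨c, hc⟩ : Coord C)) (Set.mem_ofPred.2 le_rfl) one_pos), ?_⟩
      rintro (h | ⟨h, -⟩)
      · rw [hf] at h
        exact not_leadLT_add_single (r := (⟨c, hc⟩ : Coord C)) (fun h => hcd.not_ge h) h
      · exact hcd.not_ge (h.trans (one_le_coord ht hc)) }

end Point

/-! ### Assembling the representation -/

/-- Homomorphisms from a Sugihara monoid to a DInFL-algebra: both linear negations extend the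
involution. -/
structure IsRepHom {A B : Type u} [SugiharaMonoid A] [DInFLAlgebra B] (h : A → B) : Prop where
  map_inf : ∀ a b : A, h (a ⊓ b) = h a ⊓ h b
  map_sup : ∀ a b : A, h (a ⊔ b) = h a ⊔ h b
  map_mul : ∀ a b : A, h (a * b) = h a * h b
  map_one : h 1 = 1
  map_tilde : ∀ a : A, h (neg a) = DInFLAlgebra.tilde (h a)
  map_minus : ∀ a : A, h (neg a) = DInFLAlgebra.minus (h a)

namespace IsRepHom

variable {A : Type u} [SugiharaMonoid A]

theorem one_le_map_imp {B : Type u} [DInFLAlgebra B] {h : A → B} (hh : IsRepHom h) {a b : A}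
    (hab : h a ≤ h b) : 1 ≤ h (imp a b) := by
  have hB := (isInFL_iff (A := B) _ _).1 DInFLAlgebra.isInFL
  rw [imp_eq_neg_mul, hh.map_tilde, mul_comm, hh.map_mul, hh.map_minus, ← hB.2, mul_one]
  exact hab

theorem pi {I : Type u} {B : I → Type u} [∀ i, DInFLAlgebra (B i)] {h : ∀ i, A → B i}
    (hh : ∀ i, IsRepHom (h i)) : IsRepHom fun a i => h i a where
  map_inf a b := funext fun i => (hh i).map_inf a b
  map_sup a b := funext fun i => (hh i).map_sup a b
  map_mul a b := funext fun i => (hh i).map_mul a b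
  map_one := funext fun i => (hh i).map_one
  map_tilde a := funext fun i => (hh i).map_tilde a
  map_minus a := funext fun i => (hh i).map_minus a

/-- The image of a Sugihara monoid in a DInFL-algebra. -/
def range {B : Type u} [DInFLAlgebra B] {h : A → B} (hh : IsRepHom h) : DInFLSubalgebra B where
  carrier := Set.range h
  mul_mem' := by
    rintro _ _ ⟨a, rfl⟩ ⟨b, rfl⟩
    exact ⟨_, hh.map_mul a b⟩
  one_mem' := ⟨1, hh.map_one⟩
  supClosed' := by
    rintro _ ⟨a, rfl⟩ _ ⟨b, rfl⟩
    exact ⟨_, hh.map_sup a b⟩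
  infClosed' := by
    rintro _ ⟨a, rfl⟩ _ ⟨b, rfl⟩
    exact ⟨_, hh.map_inf a b⟩
  tilde_mem := by
    rintro _ ⟨a, rfl⟩
    exact ⟨_, hh.map_tilde a⟩
  minus_mem := by
    rintro _ ⟨a, rfl⟩
    exact ⟨_, hh.map_minus a⟩

/-- A Sugihara monoid is isomorphic to the direct reduct of its image. -/
noncomputable def isoRange {B : Type u} [DInFLAlgebra B] {h : A → B} (hh : IsRepHom h)
    (hinj : Function.Injective h) : SugiharaIso A (DirectReduct hh.range.carrier) where
  toEquiv := Equiv.ofInjective h hinj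
  map_inf a b := Subtype.ext (hh.map_inf a b)
  map_sup a b := Subtype.ext (hh.map_sup a b)
  map_mul a b := Subtype.ext (hh.map_mul a b)
  map_imp a b := Subtype.ext <| by
    change h (imp a b) = DInFLAlgebra.tilde (DInFLAlgebra.minus (h b) * h a)
    rw [imp_eq_neg_mul, hh.map_tilde, mul_comm, hh.map_mul, hh.map_minus]
  map_one := Subtype.ext hh.map_one
  map_neg a := Subtype.ext (hh.map_tilde a)

end IsRepHom

/-- Every Sugihara chain has a homomorphism to a full DInFL-algebra that reflects `1 ≤ a`. -/
theorem exists_isRepHom_of_total {C : Type u} [SugiharaMonoid C]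
    (ht : ∀ a b : C, a ≤ b ∨ b ≤ a) :
    ∃ (X : Type u) (_ : PartialOrder X) (α : X ≃o X) (h : C → UpRel X α),
      IsRepHom h ∧ ∀ a, 1 ≤ h a → 1 ≤ a := by
  have main : ∀ (Y : Type) [LinearOrder Y] [Nonempty Y] (β : Y ≃o Y)
      (_ : neg (1 : C) < 1 → Subsingleton Y)
      (_ : neg (1 : C) = 1 → ∀ m n : Y, m < n ↔ m ≤ β n),
      ∃ (X : Type u) (_ : PartialOrder X) (α : X ≃o X) (h : C → UpRel X α),
        IsRepHom h ∧ ∀ a, 1 ≤ h a → 1 ≤ a := by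
    intro Y _ _ β heven hodd
    let _ := Point.partialOrder ht Y
    have hX : ∀ x y : Point C Y, x ≤ y ∨ y ≤ x := fun x y =>
      or_iff_not_imp_left.2 fun h => (not_not.1 h : x > y).le
    obtain ⟨m⟩ := ‹Nonempty Y›
    have : Nonempty (Point C Y) := ⟨⟨0, m⟩⟩
    let s := Point.scale ht β heven hodd
    exact ⟨_, _, _, s.rel ht, ⟨fun _ _ => s.rel_inf ht, fun _ _ => s.rel_sup ht,
      fun _ _ => s.rel_mul ht, s.rel_one ht hX, fun _ => s.rel_neg ht, fun _ => s.rel_neg' ht⟩,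
      fun _ => s.one_le_of_one_le_rel ht⟩
  rcases (neg_one_le_one (A := C)).eq_or_lt with h | h
  · refine main ℤ (OrderIso.addRight (-1)) (fun h' => absurd h h'.ne) fun _ m n => ?_
    rw [OrderIso.addRight_apply]
    lia
  · exact main Unit (OrderIso.refl _) (fun _ => inferInstance) fun h' => absurd h' h.ne

/-- Homomorphisms to full DInFL-algebras separate the points of a Sugihara monoid. -/
theorem exists_isRepHom_not_le {A : Type u} [SugiharaMonoid A] {a b : A} (hab : ¬ a ≤ b) :
    ∃ (X : Type u) (_ : PartialOrder X) (α : X ≃o X) (h : A → UpRel X α),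
      IsRepHom h ∧ ¬ h a ≤ h b := by
  obtain ⟨T, hT⟩ := PrimeTheory.exists_notMem (mt one_le_imp_iff.1 hab)
  obtain ⟨X, _, α, h, hh, hle⟩ := exists_isRepHom_of_total T.quot_total
  refine ⟨X, _, α, fun a => h (T.proj a), ⟨fun a b => hh.map_inf (T.proj a) (T.proj b),
    fun a b => hh.map_sup (T.proj a) (T.proj b), fun a b => hh.map_mul (T.proj a) (T.proj b),
    hh.map_one, fun a => hh.map_tilde (T.proj a),
    fun a => hh.map_minus (T.proj a)⟩,
    fun hle' => hT ?_⟩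
  exact PrimeTheory.proj_le_proj.1 (one_le_imp_iff.1 (hle _ (hh.one_le_map_imp hle')))

end SugiharaRep

theorem theorem5p11 (A : Type u) [SugiharaRep.SugiharaMonoid A] :
    SugiharaRep.IsRepresentable A := by
  open SugiharaRep in
  choose X _ α h hh hsep using fun p : {p : A × A // ¬ p.1 ≤ p.2} => exists_isRepHom_not_le p.2
  have hpi := IsRepHom.pi hh
  have hinj : Function.Injective fun a p => h p a := fun a b hab => by
    have hle : ∀ {a b : A}, (∀ p, h p a = h p b) → a ≤ b := fun {a b} hab => by
      by_contra hn
      exact hsep ⟨(a, b), hn⟩ (hab ⟨(a, b), hn⟩).le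
    exact le_antisymm (hle (congrFun hab)) (hle fun p => (congrFun hab p).symm)
  let B : DInFLAlg.{u} := ⟨hpi.range.carrier⟩
  have hP : ClassP FDInFL ⟨∀ p, UpRel (X p) (α p)⟩ :=
    ⟨_, fun p => ⟨UpRel (X p) (α p)⟩, fun p => ⟨X p, _, α p, rfl⟩, rfl⟩
  have hS : ClassS (ClassP FDInFL) B := ⟨_, hP, hpi.range, rfl⟩
  refine ⟨B, ⟨B, hS, ⟨⟨Equiv.refl _, ?_, ?_, ?_, ?_, ?_, ?_⟩⟩⟩, ⟨hpi.isoRange hinj⟩⟩ <;>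
    intros <;> rfl
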